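/- Let $\mathcal Q$ be a smooth $n$-manifold with a smooth Riemannian metric $\langle\cdot,\cdot\rangle$ (the kinetic energy metric) and smooth vector fields $X_1,\dots,X_n$ on $\mathcal Q$ that form a basis of $T_q\mathcal Q$ at every $q$; generalized velocities $v\in\mathbb R^n$ represent the tangent vector $\dot q=\sum_i v^iX_i(q)$. Let $H_{ij}=\langle X_i,X_j\rangle$ be the mass matrix, let $\nabla^\star$ be the Levi-Civita connection of the metric, and let $C^\star(q,v)$ be the Coriolis matrix $$C^\star_{ik}(q,v)=\langle X_i,\nabla^\star_{\dot q}X_k\rangle=\sum_j\Gamma^\star_{ijk}(q)\,v^j,\qquad \Gamma^\star_{ijk}=\langle X_i,\nabla^\star_{X_j}X_k\rangle .$$ Let $\overline{\mathcal Q}$ be a smooth $m$-dimensional submanifold of $\mathcal Q$ (more generally, a smooth $m$-manifold with a smooth immersion into $\mathcal Q$), with the induced Riemannian metric, and let $\overline X_1,\dots,\overline X_m$ be smooth vector fields on $\overline{\mathcal Q}$ that form a basis of $T_q\overline{\mathcal Q}$ at every $q$, with generalized velocities $\overline v\in\mathbb R^m$. Define $A(q)\in\mathbb R^{n\times m}$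 by $\overline X_j=\sum_iA^i_jX_i$ on $\overline{\mathcal Q}$, so that $v=A\overline v$, and put $\dot A^i_j=\sum_k\overline v^k\,\mathcal L_{\overline X_k}A^i_j$. Let $\overline C^\star(q,\overline v)$ be the Coriolis matrix of the Levi-Civita connection of the induced metric on $\overline{\mathcal Q}$, formed in the same way with the frame $\overline X_1,\dots,\overline X_m$. For a Coriolis matrix $C(q,v)$ on $\mathcal Q$ let $$\overline C(q,\overline v)=A^\top C(q,A\overline v)\,A+A^\top H\dot A .$$ If $C=C^\star$, then $\overline C=\overline C^\star$, i.e. $\overline C(q,\overline v)=\overline C^\star(q,\overline v)$ for all $q\in\overline{\mathcal Q}$ and $\overline v\in\mathbb R^m$. -/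

import Mathlib

open Bundle Manifold VectorField
open scoped ContDiff

noncomputable section

namespace CoriolisFactorization

set_option linter.unusedSectionVars false

section LC
variable {E : Type*} [NormedAddCommGroup E] [NormedSpace ℝ E] [FiniteDimensional ℝ E]
  {H : Type*} [TopologicalSpace H] {I : ModelWithCorners ℝ E H}
  {M : Type*} [TopologicalSpace M] [ChartedSpace H M] [IsManifold I ∞ M]

/-- `cov` is the Levi-Civita (Riemannian) connection of `g`: it is compatible with the metric,
`L_v ⟨Y, Z⟩ = ⟨∇_v Y, Z⟩ + ⟨Y, ∇_v Z⟩`, and torsion-free. In Mathlib's argument order,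
`cov Y x v` is `(∇_v Y)(x)`, and `cov.torsion` is the tensor `∇_X Y - ∇_Y X - [X, Y]`. -/
def IsLeviCivita
    (g : ContMDiffRiemannianMetric I ∞ E (fun x : M ↦ TangentSpace I x))
    (cov : CovariantDerivative I E (fun x : M ↦ TangentSpace I x)) : Prop :=
  (∀ {Y Z : Π x : M, TangentSpace I x} {x : M}, MDiffAt (T% Y) x → MDiffAt (T% Z) x →
    ∀ v : TangentSpace I x,
      mvfderiv I (fun y ↦ g.inner y (Y y) (Z y)) x v
        = g.inner x (cov Y x v) (Z x) + g.inner x (Y x) (cov Z x v)) ∧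
  cov.torsion = 0

variable (g : ContMDiffRiemannianMetric I ∞ E (fun x : M ↦ TangentSpace I x))

variable {g} in
lemma mdiff_inner {Y Z : Π x : M, TangentSpace I x} {x : M}
    (hY : MDiffAt (T% Y) x) (hZ : MDiffAt (T% Z) x) :
    MDiffAt (fun y ↦ g.inner y (Y y) (Z y)) x := by
  have h : MDifferentiableAt I (I.prod 𝓘(ℝ))
      (fun m ↦ TotalSpace.mk' ℝ (E := Bundle.Trivial M ℝ) m (g.inner m (Y m) (Z m))) x :=
    MDifferentiableAt.clm_bundle_apply₂ (F₁ := E) (F₂ := E)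
      (g.contMDiff.mdifferentiable (by simp) x) hY hZ
  simp only [mdifferentiableAt_totalSpace] at h
  exact h.2

/-- The right-hand side of the Koszul formula for `⟨∇_Y σ, Z⟩`. -/
def koszulForm (σ Y Z : Π x : M, TangentSpace I x) (x : M) : ℝ :=
  (1 / 2) * (mvfderiv I (fun y ↦ g.inner y (σ y) (Z y)) x (Y x)
    + mvfderiv I (fun y ↦ g.inner y (Y y) (Z y)) x (σ x)
    - mvfderiv I (fun y ↦ g.inner y (Y y) (σ y)) x (Z x)
    + g.inner x (mlieBracket I Y σ x) (Z x)
    - g.inner x (mlieBracket I Y Z x) (σ x)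
    - g.inner x (mlieBracket I σ Z x) (Y x))

lemma inner_smul_fun_left (f : M → ℝ) (Y Z : Π x : M, TangentSpace I x) :
    (fun y ↦ g.inner y ((f • Y) y) (Z y)) = f * (fun y ↦ g.inner y (Y y) (Z y)) := by
  ext y; simp

lemma inner_smul_fun_right (f : M → ℝ) (Y Z : Π x : M, TangentSpace I x) :
    (fun y ↦ g.inner y (Y y) ((f • Z) y)) = f * (fun y ↦ g.inner y (Y y) (Z y)) := by
  ext y; simp

lemma inner_add_fun_left (Y Y' Z : Π x : M, TangentSpace I x) :
    (fun y ↦ g.inner y ((Y + Y') y) (Z y))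
      = (fun y ↦ g.inner y (Y y) (Z y)) + (fun y ↦ g.inner y (Y' y) (Z y)) := by
  ext y; simp

lemma inner_add_fun_right (Y Z Z' : Π x : M, TangentSpace I x) :
    (fun y ↦ g.inner y (Y y) ((Z + Z') y))
      = (fun y ↦ g.inner y (Y y) (Z y)) + (fun y ↦ g.inner y (Y y) (Z' y)) := by
  ext y; simp

lemma koszul_tensorial₁ {σ Z : Π x : M, TangentSpace I x} {x : M} (hσ : MDiffAt (T% σ) x)
    (hZ : MDiffAt (T% Z) x) : TensorialAt I E (fun Y ↦ koszulForm g σ Y Z x) x where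
  smul {f Y} hf hY := by
    simp only [koszulForm]
    rw [inner_smul_fun_left, inner_smul_fun_left, mvfderiv_mul hf (mdiff_inner hY hZ),
      mvfderiv_mul hf (mdiff_inner hY hσ),
      mlieBracket_smul_left hf hY, mlieBracket_smul_left hf hY]
    simp
    ring
  add {Y Y'} hY hY' := by
    simp only [koszulForm]
    rw [inner_add_fun_left, inner_add_fun_left,
      mvfderiv_add (mdiff_inner hY hZ) (mdiff_inner hY' hZ),
      mvfderiv_add (mdiff_inner hY hσ) (mdiff_inner hY' hσ),
      mlieBracket_add_left hY hY', mlieBracket_add_left hY hY']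
    simp
    ring

lemma koszul_tensorial₂ {σ Y : Π x : M, TangentSpace I x} {x : M} (hσ : MDiffAt (T% σ) x)
    (hY : MDiffAt (T% Y) x) : TensorialAt I E (fun Z ↦ koszulForm g σ Y Z x) x where
  smul {f Z} hf hZ := by
    simp only [koszulForm]
    rw [inner_smul_fun_right, inner_smul_fun_right, mvfderiv_mul hf (mdiff_inner hσ hZ),
      mvfderiv_mul hf (mdiff_inner hY hZ),
      mlieBracket_smul_right hf hZ, mlieBracket_smul_right hf hZ]
    simp [g.symm x (Z x) (σ x), g.symm x (Z x) (Y x)]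
    ring
  add {Z Z'} hZ hZ' := by
    simp only [koszulForm]
    rw [inner_add_fun_right, inner_add_fun_right,
      mvfderiv_add (mdiff_inner hσ hZ) (mdiff_inner hσ hZ'),
      mvfderiv_add (mdiff_inner hY hZ) (mdiff_inner hY hZ'),
      mlieBracket_add_right hZ hZ', mlieBracket_add_right hZ hZ']
    simp
    ring

lemma koszul_add {σ σ' Y Z : Π x : M, TangentSpace I x} {x : M} (hσ : MDiffAt (T% σ) x)
    (hσ' : MDiffAt (T% σ') x) (hY : MDiffAt (T% Y) x) (hZ : MDiffAt (T% Z) x) :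
    koszulForm g (σ + σ') Y Z x = koszulForm g σ Y Z x + koszulForm g σ' Y Z x := by
  simp only [koszulForm]
  rw [inner_add_fun_left, inner_add_fun_right,
    mvfderiv_add (mdiff_inner hσ hZ) (mdiff_inner hσ' hZ),
    mvfderiv_add (mdiff_inner hY hσ) (mdiff_inner hY hσ'),
    mlieBracket_add_right hσ hσ', mlieBracket_add_left hσ hσ']
  simp
  ring

lemma koszul_leibniz {σ Y Z : Π x : M, TangentSpace I x} {f : M → ℝ} {x : M}
    (hσ : MDiffAt (T% σ) x) (hf : MDiffAt f x) (hY : MDiffAt (T% Y) x) (hZ : MDiffAt (T% Z) x) :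
    koszulForm g (f • σ) Y Z x
      = f x * koszulForm g σ Y Z x + mvfderiv I f x (Y x) * g.inner x (σ x) (Z x) := by
  simp only [koszulForm]
  rw [inner_smul_fun_left, inner_smul_fun_right, mvfderiv_mul hf (mdiff_inner hσ hZ),
    mvfderiv_mul hf (mdiff_inner hY hσ),
    mlieBracket_smul_right hf hσ, mlieBracket_smul_left hf hσ]
  simp [g.symm x (σ x) (Y x)]
  ring

lemma koszul_metric {σ τ Y : Π x : M, TangentSpace I x} {x : M} :
    koszulForm g σ Y τ x + koszulForm g τ Y σ x
      = mvfderiv I (fun y ↦ g.inner y (σ y) (τ y)) x (Y x) := by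
  have e : (fun y ↦ g.inner y (τ y) (σ y)) = (fun y ↦ g.inner y (σ y) (τ y)) := by
    ext y; exact g.symm _ _ _
  simp only [koszulForm]
  rw [e, mlieBracket_swap_apply (V := τ) (W := σ)]
  simp
  ring

lemma koszul_torsion {σ Y Z : Π x : M, TangentSpace I x} {x : M} :
    koszulForm g σ Y Z x - koszulForm g Y σ Z x = g.inner x (mlieBracket I Y σ x) (Z x) := by
  have e : (fun y ↦ g.inner y (σ y) (Y y)) = (fun y ↦ g.inner y (Y y) (σ y)) := by
    ext y; exact g.symm _ _ _
  simp only [koszulForm]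
  rw [e, mlieBracket_swap_apply (V := σ) (W := Y)]
  simp
  ring

lemma eq_of_inner {x : M} {u w : TangentSpace I x} (h : ∀ z, g.inner x u z = g.inner x w z) :
    u = w := by
  by_contra hne
  have := g.pos x (u - w) (sub_ne_zero.2 hne)
  simp [h] at this

lemma exists_sharp (x : M) (B : TangentSpace I x →L[ℝ] TangentSpace I x →L[ℝ] ℝ) :
    ∃ T : TangentSpace I x →L[ℝ] TangentSpace I x, ∀ v w, g.inner x (T v) w = B v w := by
  have : FiniteDimensional ℝ (TangentSpace I x) := inferInstanceAs (FiniteDimensional ℝ E)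
  have : T2Space (TangentSpace I x) := inferInstanceAs (T2Space E)
  let L : TangentSpace I x →ₗ[ℝ] Module.Dual ℝ (TangentSpace I x) :=
    { toFun := fun u ↦ (g.inner x u).toLinearMap
      map_add' := by intros; ext; simp
      map_smul' := by intros; ext; simp }
  have hL : Function.Injective L := fun u w h ↦ eq_of_inner g fun z ↦ congr($h z)
  let e := LinearMap.linearEquivOfInjective L hL Subspace.dual_finrank_eq.symm
  let B' : TangentSpace I x →ₗ[ℝ] Module.Dual ℝ (TangentSpace I x) :=
    { toFun := fun u ↦ (B u).toLinearMap
      map_add' := by intros; ext; simp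
      map_smul' := by intros; ext; simp }
  refine ⟨LinearMap.toContinuousLinearMap (e.symm.toLinearMap ∘ₗ B'), fun v w ↦ ?_⟩
  have : L (e.symm (B' v)) = B' v := e.apply_symm_apply (B' v)
  exact congr($this w)

/-- Existence of the Levi-Civita connection. -/
theorem exists_isLeviCivita : ∃ cov, IsLeviCivita g cov := by
  classical
  have key : ∀ (σ : Π x : M, TangentSpace I x) (x : M),
      ∃ T : TangentSpace I x →L[ℝ] TangentSpace I x, MDiffAt (T% σ) x →
        ∀ Y Z : Π x : M, TangentSpace I x, MDiffAt (T% Y) x → MDiffAt (T% Z) x →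
          g.inner x (T (Y x)) (Z x) = koszulForm g σ Y Z x := by
    intro σ x
    by_cases hσ : MDiffAt (T% σ) x
    · obtain ⟨T, hT⟩ := exists_sharp g x (TensorialAt.mkHom₂ (I := I) (F := E) (F' := E)
        (fun Y Z ↦ koszulForm g σ Y Z x) x
        (fun Z hZ ↦ koszul_tensorial₁ g hσ hZ) (fun Y hY ↦ koszul_tensorial₂ g hσ hY))
      refine ⟨T, fun _ Y Z hY hZ ↦ ?_⟩
      rw [hT]
      exact TensorialAt.mkHom₂_apply _ _ hY hZ
    · exact ⟨0, fun h ↦ (hσ h).elim⟩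
  choose cov hcov using key
  have spec : ∀ {σ : Π x : M, TangentSpace I x} {x : M}, MDiffAt (T% σ) x → ∀ v w,
      g.inner x (cov σ x v) w
        = koszulForm g σ (FiberBundle.extend E v) (FiberBundle.extend E w) x := by
    intro σ x hσ v w
    simpa using hcov σ x hσ (FiberBundle.extend E v) (FiberBundle.extend E w)
      (FiberBundle.mdifferentiableAt_extend ..) (FiberBundle.mdifferentiableAt_extend ..)
  let C : CovariantDerivative I E (fun x : M ↦ TangentSpace I x) :=
    { toFun := cov
      isCovariantDerivativeOnUniv :=
        { add := by
            intro σ σ' x hσ hσ' _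
            ext1 v
            refine eq_of_inner g fun w ↦ ?_
            rw [spec (mdifferentiableAt_add_section hσ hσ'), koszul_add g hσ hσ'
              (FiberBundle.mdifferentiableAt_extend ..) (FiberBundle.mdifferentiableAt_extend ..),
              ← spec hσ, ← spec hσ']
            simp
          leibniz := by
            intro σ f x hσ hf _
            ext1 v
            refine eq_of_inner g fun w ↦ ?_
            rw [spec (hf.smul_section hσ), koszul_leibniz g hσ hf
              (FiberBundle.mdifferentiableAt_extend ..) (FiberBundle.mdifferentiableAt_extend ..),
              ← spec hσ]
            simp } }
  refine ⟨C, ?_, ?_⟩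
  · intro Y Z x hY hZ v
    rw [g.symm x (Y x)]
    have h1 := hcov Y x hY (FiberBundle.extend E v) Z (FiberBundle.mdifferentiableAt_extend ..) hZ
    have h2 := hcov Z x hZ (FiberBundle.extend E v) Y (FiberBundle.mdifferentiableAt_extend ..) hY
    have h3 := koszul_metric g (σ := Y) (τ := Z) (Y := FiberBundle.extend E v) (x := x)
    rw [← h1, ← h2] at h3
    simpa using h3.symm
  · rw [CovariantDerivative.torsion_eq_zero_iff]
    intro X Y x hX hY
    refine eq_of_inner g fun w ↦ ?_
    have h1 := hcov Y x hY X (FiberBundle.extend E w) hX (FiberBundle.mdifferentiableAt_extend ..)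
    have h2 := hcov X x hX Y (FiberBundle.extend E w) hY (FiberBundle.mdifferentiableAt_extend ..)
    have h3 := koszul_torsion g (σ := Y) (Y := X) (Z := FiberBundle.extend E w) (x := x)
    rw [← h1, ← h2] at h3
    simpa using h3

theorem IsLeviCivita.eq_koszulForm
    {g : ContMDiffRiemannianMetric I ∞ E (fun x : M ↦ TangentSpace I x)}
    {cov : CovariantDerivative I E (fun x : M ↦ TangentSpace I x)} (h : IsLeviCivita g cov)
    {σ Y Z : Π x : M, TangentSpace I x} {x : M} (hσ : MDiffAt (T% σ) x) (hY : MDiffAt (T% Y) x)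
    (hZ : MDiffAt (T% Z) x) : g.inner x (cov σ x (Y x)) (Z x) = koszulForm g σ Y Z x := by
  have ht {V W : Π x : M, TangentSpace I x} (hV : MDiffAt (T% V) x) (hW : MDiffAt (T% W) x) :
      cov W x (V x) - cov V x (W x) = mlieBracket I V W x :=
    (CovariantDerivative.torsion_eq_zero_iff cov).1 h.2 hV hW
  simp only [koszulForm]
  rw [h.1 hσ hZ, h.1 hY hZ, h.1 hY hσ, ← ht hY hσ, ← ht hY hZ, ← ht hσ hZ]
  simp only [map_sub, sub_apply, g.symm x (σ x), g.symm x (Y x)]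
  ring

/-- Uniqueness of the Levi-Civita connection (on differentiable vector fields). -/
theorem IsLeviCivita.unique
    {g : ContMDiffRiemannianMetric I ∞ E (fun x : M ↦ TangentSpace I x)}
    {cov cov' : CovariantDerivative I E (fun x : M ↦ TangentSpace I x)}
    (h : IsLeviCivita g cov) (h' : IsLeviCivita g cov') {σ : Π x : M, TangentSpace I x} {x : M}
    (hσ : MDiffAt (T% σ) x) : cov σ x = cov' σ x := by
  ext1 v
  refine eq_of_inner g fun w ↦ ?_
  have h1 := h.eq_koszulForm hσ (FiberBundle.mdifferentiableAt_extend (F := E) I v)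
    (FiberBundle.mdifferentiableAt_extend (F := E) I w)
  have h2 := h'.eq_koszulForm hσ (FiberBundle.mdifferentiableAt_extend (F := E) I v)
    (FiberBundle.mdifferentiableAt_extend (F := E) I w)
  simpa using h1.trans h2.symm

/-- The Levi-Civita connection of `g`. -/
def leviCivita : CovariantDerivative I E (fun x : M ↦ TangentSpace I x) :=
  (exists_isLeviCivita g).choose

theorem isLeviCivita_leviCivita : IsLeviCivita g (leviCivita g) :=
  (exists_isLeviCivita g).choose_spec

end LC

section Induced
variable {E : Type*} [NormedAddCommGroup E] [NormedSpace ℝ E] [FiniteDimensional ℝ E]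
  {H : Type*} [TopologicalSpace H] {I : ModelWithCorners ℝ E H}
  {M : Type*} [TopologicalSpace M] [ChartedSpace H M] [IsManifold I ∞ M]
  {E' : Type*} [NormedAddCommGroup E'] [NormedSpace ℝ E'] [FiniteDimensional ℝ E']
  {H' : Type*} [TopologicalSpace H'] {J : ModelWithCorners ℝ E' H'}
  {N : Type*} [TopologicalSpace N] [ChartedSpace H' N] [IsManifold J ∞ N]

/-- The bilinear form `(v, w) ↦ ⟨df v, df w⟩` on `T_x N`. -/
def pullbackForm (g : ContMDiffRiemannianMetric I ∞ E (fun x : M ↦ TangentSpace I x))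
    (f : N → M) (x : N) : TangentSpace J x →L[ℝ] TangentSpace J x →L[ℝ] ℝ :=
  ContinuousLinearMap.precomp ℝ (mfderiv J I f x) ∘L g.inner (f x) ∘L mfderiv J I f x

lemma pullbackForm_apply (g : ContMDiffRiemannianMetric I ∞ E (fun x : M ↦ TangentSpace I x))
    (f : N → M) (x : N) (v w : TangentSpace J x) :
    pullbackForm (J := J) g f x v w
      = g.inner (f x) (mfderiv J I f x v) (mfderiv J I f x w) := rfl

lemma contDiff_bilinearComp {E E' : Type*} [NormedAddCommGroup E] [NormedSpace ℝ E]
    [NormedAddCommGroup E'] [NormedSpace ℝ E'] [FiniteDimensional ℝ E'] :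
    ContDiff ℝ ∞ (fun p : (E →L[ℝ] E →L[ℝ] ℝ) × (E' →L[ℝ] E) ↦
      ContinuousLinearMap.bilinearComp p.1 p.2 p.2) := by
  refine contDiff_clm_apply_iff.2 fun v ↦ contDiff_clm_apply_iff.2 fun w ↦ ?_
  simp only [ContinuousLinearMap.bilinearComp_apply]
  exact (contDiff_fst.clm_apply (contDiff_snd.clm_apply contDiff_const)).clm_apply
    (contDiff_snd.clm_apply contDiff_const)

lemma isVonNBounded_pullbackForm
    (g : ContMDiffRiemannianMetric I ∞ E (fun x : M ↦ TangentSpace I x))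
    (f : N → M) (x : N) (hf : Function.Injective (mfderiv J I f x)) :
    Bornology.IsVonNBounded ℝ {v : TangentSpace J x | pullbackForm (J := J) g f x v v < 1} := by
  have : FiniteDimensional ℝ (TangentSpace J x) := inferInstanceAs (FiniteDimensional ℝ E')
  have : FiniteDimensional ℝ (TangentSpace I (f x)) := inferInstanceAs (FiniteDimensional ℝ E)
  have : T2Space (TangentSpace I (f x)) := inferInstanceAs (T2Space E)
  obtain ⟨L, hL⟩ := (mfderiv J I f x).toLinearMap.exists_leftInverse_of_injective
    (LinearMap.ker_eq_bot.2 hf)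
  refine ((g.isVonNBounded (f x)).image (LinearMap.toContinuousLinearMap L)).subset ?_
  intro v hv
  exact ⟨mfderiv J I f x v, hv, congr($hL v)⟩

lemma contMDiff_pullbackForm
    (g : ContMDiffRiemannianMetric I ∞ E (fun x : M ↦ TangentSpace I x))
    {f : N → M} (hf : ContMDiff J I ∞ f) :
    ContMDiff J (J.prod 𝓘(ℝ, E' →L[ℝ] E' →L[ℝ] ℝ)) ∞
      (fun x ↦ TotalSpace.mk' (E' →L[ℝ] E' →L[ℝ] ℝ)
        (E := fun x : N ↦ TangentSpace J x →L[ℝ] TangentSpace J x →L[ℝ] ℝ) x (pullbackForm (J := J) g f x)) := by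
  intro x₀
  have hD := (hf x₀).mfderiv_const (m := ∞) (by simp)
  have hG := (contMDiffAt_hom_bundle _).1 (g.contMDiff.comp hf x₀)
  rw [contMDiffAt_hom_bundle]
  refine ⟨contMDiffAt_id, ?_⟩
  replace hG := hG.2
  simp only [Function.comp_def] at hG
  have hcomp := (contDiff_bilinearComp (E := E) (E' := E')).contMDiff.contMDiffAt.comp x₀
    (hG.prodMk_space hD)
  refine hcomp.congr_of_eventuallyEq ?_
  have A : ∀ᶠ x in nhds x₀, x ∈ (trivializationAt E' (TangentSpace J) x₀).baseSet :=
    (trivializationAt E' (TangentSpace J) x₀).open_baseSet.mem_nhds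
      (FiberBundle.mem_baseSet_trivializationAt' x₀)
  have B : ∀ᶠ x in nhds x₀, f x ∈ (trivializationAt E (TangentSpace I) (f x₀)).baseSet :=
    hf.continuous.continuousAt.eventually
      ((trivializationAt E (TangentSpace I) (f x₀)).open_baseSet.mem_nhds
      (FiberBundle.mem_baseSet_trivializationAt' (f x₀)))
  filter_upwards [A, B] with x hx hfx
  ext v w
  rw [inCoordinates_apply_eq₂ hx hx (Set.mem_univ _)]
  simp only [Function.comp_apply, ContinuousLinearMap.bilinearComp_apply]
  rw [inCoordinates_apply_eq₂ hfx hfx (Set.mem_univ _)]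
  simp only [inTangentCoordinates, pullbackForm_apply, id]
  rw [ContinuousLinearMap.inCoordinates_eq hx hfx]
  simp [Trivialization.symm_apply_apply_mk _ hfx]

/-- The Riemannian metric induced on `N` by a smooth immersion `f : N → M`: `⟨v, w⟩ = ⟨df v, df w⟩`. -/
def inducedMetric (g : ContMDiffRiemannianMetric I ∞ E (fun x : M ↦ TangentSpace I x))
    (f : N → M) (hf : ContMDiff J I ∞ f) (hf' : ∀ x, Function.Injective (mfderiv J I f x)) :
    ContMDiffRiemannianMetric J ∞ E' (fun x : N ↦ TangentSpace J x) where
  inner := pullbackForm g f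
  symm x v w := g.symm (f x) _ _
  pos x v hv := g.pos (f x) _ (fun h ↦ hv (hf' x (by simpa using h)))
  isVonNBounded x := isVonNBounded_pullbackForm g f x (hf' x)
  contMDiff := contMDiff_pullbackForm g hf

end Induced

section Coriolis
variable {E : Type*} [NormedAddCommGroup E] [NormedSpace ℝ E] [FiniteDimensional ℝ E]
  {H : Type*} [TopologicalSpace H] {I : ModelWithCorners ℝ E H}
  {M : Type*} [TopologicalSpace M] [ChartedSpace H M] [IsManifold I ∞ M] {n : ℕ}

/-- The tangent vector `q̇ = X_i v^i` at `q` with generalized velocities `v`. -/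
def velocity (X : Fin n → Π x : M, TangentSpace I x) (q : M) (v : Fin n → ℝ) :
    TangentSpace I q :=
  ∑ i, v i • X i q

/-- The mass matrix `H_ij = ⟨X_i, X_j⟩` of the metric `g` in the frame `X`. -/
def massMatrix (g : ContMDiffRiemannianMetric I ∞ E (fun x : M ↦ TangentSpace I x))
    (X : Fin n → Π x : M, TangentSpace I x) (q : M) : Matrix (Fin n) (Fin n) ℝ :=
  Matrix.of fun i j ↦ g.inner q (X i q) (X j q)

/-- The Coriolis matrix of a connection: `C_ik(q, v) = ⟨X_i, ∇_q̇ X_k⟩ = Γ_ijk v^j`, where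
`Γ_ijk = ⟨X_i, ∇_{X_j} X_k⟩`. -/
def coriolisMatrix (g : ContMDiffRiemannianMetric I ∞ E (fun x : M ↦ TangentSpace I x))
    (cov : CovariantDerivative I E (fun x : M ↦ TangentSpace I x))
    (X : Fin n → Π x : M, TangentSpace I x) (q : M) (v : Fin n → ℝ) :
    Matrix (Fin n) (Fin n) ℝ :=
  Matrix.of fun i k ↦ g.inner q (X i q) (cov (X k) q (velocity X q v))

/-- The Christoffel-consistent Coriolis matrix `C⋆`: the one of the Levi-Civita connection. -/
def coriolisStar (g : ContMDiffRiemannianMetric I ∞ E (fun x : M ↦ TangentSpace I x))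
    (X : Fin n → Π x : M, TangentSpace I x) (q : M) (v : Fin n → ℝ) :
    Matrix (Fin n) (Fin n) ℝ :=
  coriolisMatrix g (leviCivita g) X q v

variable {E' : Type*} [NormedAddCommGroup E'] [NormedSpace ℝ E']
  {H' : Type*} [TopologicalSpace H'] {J : ModelWithCorners ℝ E' H'}
  {N : Type*} [TopologicalSpace N] [ChartedSpace H' N] {m : ℕ}

/-- The matrix `A(q)` with `X̄_j = A^i_j X_i`, i.e. whose `j`-th column holds the components of
`df (X̄_j)` in the frame `X`. -/
def frameMatrix {X : Fin n → Π x : M, TangentSpace I x}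
    (hX : IsLocalFrameOn I E ∞ X Set.univ) (f : N → M)
    (Xbar : Fin m → Π y : N, TangentSpace J y) (q : N) : Matrix (Fin n) (Fin m) ℝ :=
  Matrix.of fun i j ↦ hX.coeff i (f q) (mfderiv J I f q (Xbar j q))

/-- The matrix `Ȧ^i_j = v̄^k L_{X̄_k} A^i_j`. -/
def frameMatrixDot {X : Fin n → Π x : M, TangentSpace I x}
    (hX : IsLocalFrameOn I E ∞ X Set.univ) (f : N → M)
    (Xbar : Fin m → Π y : N, TangentSpace J y) (q : N) (vbar : Fin m → ℝ) :
    Matrix (Fin n) (Fin m) ℝ :=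
  Matrix.of fun i j ↦
    ∑ k, vbar k * mvfderiv J (fun y ↦ frameMatrix hX f Xbar y i j) q (Xbar k q)

open Matrix in
/-- The transformation law `C̄ = Aᵀ C A + Aᵀ H Ȧ`, where `C` is evaluated at `v = A v̄`. -/
def inducedCoriolis (g : ContMDiffRiemannianMetric I ∞ E (fun x : M ↦ TangentSpace I x))
    {X : Fin n → Π x : M, TangentSpace I x} (hX : IsLocalFrameOn I E ∞ X Set.univ)
    (C : M → (Fin n → ℝ) → Matrix (Fin n) (Fin n) ℝ) (f : N → M)
    (Xbar : Fin m → Π y : N, TangentSpace J y) (q : N) (vbar : Fin m → ℝ) :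
    Matrix (Fin m) (Fin m) ℝ :=
  let A := frameMatrix hX f Xbar q
  Aᵀ * C (f q) (A *ᵥ vbar) * A
    + Aᵀ * massMatrix g X (f q) * frameMatrixDot hX f Xbar q vbar

end Coriolis

end CoriolisFactorization

end

/-! Entrywise, `Aᵀ C A + Aᵀ H Ȧ` is ⟨df X̄_i, D(df X̄_j)⟩, where D is the covariant derivative along
f in the direction of the velocity: by the product rule, differentiating df X̄_j = ∑ A^k_j X_k∘f
gives an Ȧ term and a ∇X_k term (`inducedCoriolis_apply`). The theorem is then the Gauss formula:
the tangential part of the ambient Levi-Civita connection along f is the Levi-Civita connection of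
the induced metric.

No vector field on N is extended to M. D is defined by components in the frame X (`covAlong`), and
it inherits two properties from ∇⋆: compatibility with the pulled-back metric
(`mvfderiv_pullbackForm`) and D_Y Z - D_Z Y = df[Y, Z] (`covAlong_sub_covAlong`). These two
identities give the Koszul formula for the induced metric (`inner_covAlong_eq_koszulForm`), which
its Levi-Civita connection also satisfies.

The analytic input is an expression for df[Y, Z] in components (`mfderiv_mlieBracket_of_eq_sum`). It
is obtained by letting brackets act as commutators of derivations on a chart of M. -/

noncomputable section

namespace CoriolisFactorization

set_option linter.unusedSectionVars false

/-! ### Lie brackets as commutators of derivations. -/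

section VectorFieldsAsDerivations
variable {E : Type*} [NormedAddCommGroup E] [NormedSpace ℝ E] [FiniteDimensional ℝ E]
  {H : Type*} [TopologicalSpace H] {I : ModelWithCorners ℝ E H}
  {M : Type*} [TopologicalSpace M] [ChartedSpace H M] [IsManifold I ∞ M]
  {F : Type*} [NormedAddCommGroup F] [NormedSpace ℝ F]

/-- The derivative of a `C²` function along a differentiable vector field is differentiable. -/
lemma mdifferentiableAt_mvfderiv_apply {h : M → F} {Y : Π x : M, TangentSpace I x} {x : M}
    (hh : ContMDiffAt I 𝓘(ℝ, F) 2 h x) (hY : MDiffAt (T% Y) x) :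
    MDiffAt (fun y ↦ mvfderiv I h y (Y y)) x := by
  have hD := ((hh.mfderiv_const (m := 1) (by norm_num)).mdifferentiableAt one_ne_zero)
  have := MDifferentiableAt.clm_apply_of_inCoordinates (b₁ := id) (b₂ := h) hD hY
    (hh.mdifferentiableAt (by simp))
  exact ((contMDiff_snd_tangentBundle_modelSpace F 𝓘(ℝ, F)).contMDiffAt.mdifferentiableAt
    one_ne_zero).comp x this

/-- Pulling back by ψ reduces the identity to the one in the vector space E, where it is the
symmetry of the second derivative of h ∘ ψ; brackets are natural under such pullbacks. -/
lemma mvfderiv_mlieBracket_of_isInvertible {h : M → F} {V W : Π x : M, TangentSpace I x}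
    {ψ : E → M} {u : E} (hψ : ContMDiffAt 𝓘(ℝ, E) I 2 ψ u)
    (hψ' : ∀ᶠ y in nhds u, (mfderiv 𝓘(ℝ, E) I ψ y).IsInvertible)
    (hh : ContMDiffAt I 𝓘(ℝ, F) 2 h (ψ u)) (hV : MDiffAt (T% V) (ψ u))
    (hW : MDiffAt (T% W) (ψ u)) :
    mvfderiv I h (ψ u) (mlieBracket I V W (ψ u))
      = mvfderiv I (fun y ↦ mvfderiv I h y (W y)) (ψ u) (V (ψ u))
        - mvfderiv I (fun y ↦ mvfderiv I h y (V y)) (ψ u) (W (ψ u)) := by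
  have : IsManifold I 2 M := IsManifold.of_le (m := 2) (n := ∞) ENat.LEInfty.out
  have : IsManifold I (minSmoothness ℝ 2) M := by simpa
  have hu := hψ'.self_of_nhds
  have hψd := hψ.mdifferentiableAt two_ne_zero
  set V' : E → E := mpullback 𝓘(ℝ, E) I ψ V with hV'
  set W' : E → E := mpullback 𝓘(ℝ, E) I ψ W with hW'
  have diff {Z : Π x : M, TangentSpace I x} (hZ : MDiffAt (T% Z) (ψ u)) :
      DifferentiableAt ℝ (mpullback 𝓘(ℝ, E) I ψ Z : E → E) u :=
    (((contMDiff_snd_tangentBundle_modelSpace E 𝓘(ℝ, E)).contMDiffAt.mdifferentiableAt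
      one_ne_zero).comp u (hZ.mpullback_vectorField hψ hu le_rfl)).differentiableAt
  have push (Z : Π x : M, TangentSpace I x) {y : E}
      (hy : (mfderiv 𝓘(ℝ, E) I ψ y).IsInvertible) :
      mfderiv 𝓘(ℝ, E) I ψ y (mpullback 𝓘(ℝ, E) I ψ Z y) = Z (ψ y) := by
    rw [mpullback_apply]; exact hy.self_apply_inverse _
  have ev : ∀ᶠ y in nhds u, MDiffAt h (ψ y) ∧ MDiffAt ψ y ∧
      (mfderiv 𝓘(ℝ, E) I ψ y).IsInvertible := by
    have h1 := (contMDiffAt_iff_contMDiffAt_nhds (n := 2) (by simp)).1 hψ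
    have h2 := (contMDiffAt_iff_contMDiffAt_nhds (n := 2) (by simp)).1 hh
    filter_upwards [h1, hψ.continuousAt.eventually h2, hψ'] with y hy hy' hy''
    exact ⟨hy'.mdifferentiableAt two_ne_zero, hy.mdifferentiableAt two_ne_zero, hy''⟩
  have chain (Z : Π x : M, TangentSpace I x) :
      (fun y ↦ fderiv ℝ (h ∘ ψ) y ((mpullback 𝓘(ℝ, E) I ψ Z : E → E) y))
        =ᶠ[nhds u] (fun z ↦ mvfderiv I h z (Z z)) ∘ ψ := by
    filter_upwards [ev] with y ⟨h1, h2, h3⟩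
    rw [← mfderiv_eq_fderiv]
    refine (mfderiv_comp_apply y h1 h2 _).trans ?_
    rw [push Z h3]; rfl
  have deriv {Z T : Π x : M, TangentSpace I x} (hZ : MDiffAt (T% Z) (ψ u)) :
      fderiv ℝ (fun y ↦ fderiv ℝ (h ∘ ψ) y ((mpullback 𝓘(ℝ, E) I ψ Z : E → E) y)) u
        ((mpullback 𝓘(ℝ, E) I ψ T : E → E) u)
        = mvfderiv I (fun z ↦ mvfderiv I h z (Z z)) (ψ u) (T (ψ u)) := by
    rw [(chain Z).fderiv_eq, ← mfderiv_eq_fderiv]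
    refine (mfderiv_comp_apply u (mdifferentiableAt_mvfderiv_apply hh hZ) hψd _).trans ?_
    rw [push T hu]; rfl
  have key := fderiv_apply_lieBracket (f := h ∘ ψ) (V := V') (W := W') (n := 2)
    (hh.comp u hψ).contDiffAt (by simp) (diff hW) (diff hV)
  rw [deriv hV, deriv hW] at key
  have hb : mlieBracket 𝓘(ℝ, E) V' W' u = lieBracket ℝ V' W' u := by
    rw [← mlieBracketWithin_univ, mlieBracketWithin_eq_lieBracketWithin]
    exact congrFun lieBracketWithin_univ u
  rw [← key, ← push (mlieBracket I V W) hu, mpullback_mlieBracket hV hW hψ (by simp), ← hb,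
    ← mfderiv_eq_fderiv]
  exact (mfderiv_comp_apply u (hh.mdifferentiableAt two_ne_zero) hψd _).symm

/-- The Lie bracket is the commutator of the vector fields as derivations on `C²` functions. -/
lemma mvfderiv_mlieBracket [I.Boundaryless] {h : M → F} {V W : Π x : M, TangentSpace I x} {x : M}
    (hh : ContMDiffAt I 𝓘(ℝ, F) 2 h x) (hV : MDiffAt (T% V) x) (hW : MDiffAt (T% W) x) :
    mvfderiv I h x (mlieBracket I V W x)
      = mvfderiv I (fun y ↦ mvfderiv I h y (W y)) x (V x)
        - mvfderiv I (fun y ↦ mvfderiv I h y (V y)) x (W x) := by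
  have : IsManifold I 2 M := IsManifold.of_le (m := 2) (n := ∞) ENat.LEInfty.out
  have hmem := extChartAt_target_mem_nhds (I := I) x
  -- The preceding lemma speaks of points of the form ψ u. Since x also occurs in the types of
  -- tangent vectors, the point is generalized so that `rfl` can replace it by the chart expression.
  have aux : ∀ x', (extChartAt I x).symm (extChartAt I x x) = x' →
      ContMDiffAt I 𝓘(ℝ, F) 2 h x' → MDiffAt (T% V) x' → MDiffAt (T% W) x' →
      mvfderiv I h x' (mlieBracket I V W x')
        = mvfderiv I (fun y ↦ mvfderiv I h y (W y)) x' (V x')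
          - mvfderiv I (fun y ↦ mvfderiv I h y (V y)) x' (W x') := by
    rintro _ rfl hh hV hW
    refine mvfderiv_mlieBracket_of_isInvertible
      ((contMDiffOn_extChartAt_symm x).contMDiffAt hmem) ?_ hh hV hW
    filter_upwards [hmem] with y hy
    have := isInvertible_mfderivWithin_extChartAt_symm (I := I) hy
    rwa [I.range_eq_univ, mfderivWithin_univ] at this
  exact aux x (extChartAt_to_inv x) hh hV hW

end VectorFieldsAsDerivations

/-! ### Product rules on N and brackets of vector fields pushed forward along a map. -/

section AlongMap
variable {E : Type*} [NormedAddCommGroup E] [NormedSpace ℝ E] [FiniteDimensional ℝ E]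
  {H : Type*} [TopologicalSpace H] {I : ModelWithCorners ℝ E H}
  {M : Type*} [TopologicalSpace M] [ChartedSpace H M] [IsManifold I ∞ M]
  {E' : Type*} [NormedAddCommGroup E'] [NormedSpace ℝ E'] [FiniteDimensional ℝ E']
  {H' : Type*} [TopologicalSpace H'] {J : ModelWithCorners ℝ E' H'}
  {N : Type*} [TopologicalSpace N] [ChartedSpace H' N] [IsManifold J ∞ N]
  {F : Type*} [NormedAddCommGroup F] [NormedSpace ℝ F]
  {ι : Type*} [Fintype ι]

lemma mdifferentiableAt_sum {u : ι → N → F} {q : N} {s : Finset ι}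
    (hu : ∀ i, MDiffAt (u i) q) : MDiffAt (fun y ↦ ∑ i ∈ s, u i y) q := by
  classical
  induction s using Finset.induction_on with
  | empty => simpa using mdifferentiableAt_const
  | insert i s hi ih =>
    simp only [Finset.sum_insert hi]
    exact (hu i).add ih

lemma mvfderiv_sum {u : ι → N → F} {q : N} {s : Finset ι} (hu : ∀ i, MDiffAt (u i) q) :
    mvfderiv J (fun y ↦ ∑ i ∈ s, u i y) q = ∑ i ∈ s, mvfderiv J (u i) q := by
  classical
  induction s using Finset.induction_on with
  | empty => simpa using mvfderiv_const (I := J) (0 : F) (x := q)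
  | insert i s hi ih =>
    simp only [Finset.sum_insert hi]
    rw [← ih]
    exact mvfderiv_add (hu i) (mdifferentiableAt_sum hu)

lemma mvfderiv_sum_smul_apply {a : ι → N → ℝ} {u : ι → N → F} {q : N}
    (ha : ∀ i, MDiffAt (a i) q) (hu : ∀ i, MDiffAt (u i) q) (v : TangentSpace J q) :
    mvfderiv J (fun y ↦ ∑ i, a i y • u i y) q v
      = ∑ i, (mvfderiv J (a i) q v • u i q + a i q • mvfderiv J (u i) q v) := by
  rw [mvfderiv_sum (u := fun i y ↦ a i y • u i y) fun i ↦ (ha i).smul (hu i),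
    sum_apply]
  refine Finset.sum_congr rfl fun i _ ↦ ?_
  have := congr($(mvfderiv_smul (ha i) (hu i)) v)
  rw [add_comm]
  exact this

lemma mvfderiv_congr {u u' : N → F} {q : N} (h : u =ᶠ[nhds q] u') :
    mvfderiv J u q = mvfderiv J u' q :=
  h.mfderiv_eq

lemma mvfderiv_comp_apply' {h : M → F} {f : N → M} {q : N} (hh : MDiffAt h (f q))
    (hf : MDiffAt f q) (v : TangentSpace J q) :
    mvfderiv J (h ∘ f) q v = mvfderiv I h (f q) (mfderiv J I f q v) :=
  mfderiv_comp_apply q hh hf v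

lemma mvfderiv_extChartAt_injective (x : M) :
    Function.Injective (mvfderiv I (extChartAt I x) x) :=
  (isInvertible_mfderiv_extChartAt (I := I) (mem_extChartAt_source x)).injective

/-- The Lie bracket of vector fields on `N`, pushed forward along `f : N → M`, in terms of their
components with respect to vector fields on `M`. -/
lemma mfderiv_mlieBracket_of_eq_sum [I.Boundaryless] [J.Boundaryless] {f : N → M} {q : N}
    (hf : ContMDiffAt J I 2 f q) {X : ι → Π x : M, TangentSpace I x}
    (hX : ∀ i, MDiffAt (T% (X i)) (f q)) {Y Z : Π y : N, TangentSpace J y}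
    (hY : MDiffAt (T% Y) q) (hZ : MDiffAt (T% Z) q) {a b : ι → N → ℝ}
    (ha : ∀ i, MDiffAt (a i) q) (hb : ∀ i, MDiffAt (b i) q)
    (hYa : ∀ y, mfderiv J I f y (Y y) = ∑ i, a i y • X i (f y))
    (hZb : ∀ y, mfderiv J I f y (Z y) = ∑ i, b i y • X i (f y)) :
    mfderiv J I f q (mlieBracket J Y Z q)
      = ∑ i, (mvfderiv J (b i) q (Y q) - mvfderiv J (a i) q (Z q)) • X i (f q)
        + ∑ i, ∑ j, (a i q * b j q) • mlieBracket I (X i) (X j) (f q) := by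
  have hfd := hf.mdifferentiableAt two_ne_zero
  -- The chart serves as a vector-valued test function: its differential at f q is injective, so the
  -- identity may be checked after applying it.
  set φ : M → E := ⇑(extChartAt I (f q)) with hφ
  have hφ2 : ContMDiffAt I 𝓘(ℝ, E) 2 φ (f q) := contMDiffAt_extChartAt
  have hφd := hφ2.mdifferentiableAt two_ne_zero
  have hXd i : MDiffAt (fun x ↦ mvfderiv I φ x (X i x)) (f q) :=
    mdifferentiableAt_mvfderiv_apply hφ2 (hX i)
  have along {W : Π y : N, TangentSpace J y} {c : ι → N → ℝ} (hc : ∀ i, MDiffAt (c i) q)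
      (hW : ∀ y, mfderiv J I f y (W y) = ∑ i, c i y • X i (f y)) (v : TangentSpace J q) :
      mvfderiv J (fun y ↦ mvfderiv J (φ ∘ f) y (W y)) q v
        = ∑ i, (mvfderiv J (c i) q v • mvfderiv I φ (f q) (X i (f q))
          + c i q • mvfderiv I (fun x ↦ mvfderiv I φ x (X i x)) (f q) (mfderiv J I f q v)) := by
    have ev : (fun y ↦ mvfderiv J (φ ∘ f) y (W y))
        =ᶠ[nhds q] fun y ↦ ∑ i, c i y • ((fun x ↦ mvfderiv I φ x (X i x)) ∘ f) y := by
      have h1 := (contMDiffAt_iff_contMDiffAt_nhds (n := 2) (by simp)).1 hf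
      have h2 := (contMDiffAt_iff_contMDiffAt_nhds (n := 2) (by simp)).1 hφ2
      filter_upwards [h1, hf.continuousAt.eventually h2] with y h1 h2
      rw [mvfderiv_comp_apply' (h2.mdifferentiableAt two_ne_zero)
        (h1.mdifferentiableAt two_ne_zero), hW, map_sum]
      simp
    rw [mvfderiv_congr ev, mvfderiv_sum_smul_apply hc fun i ↦ (hXd i).comp q hfd]
    refine Finset.sum_congr rfl fun i _ ↦ ?_
    rw [mvfderiv_comp_apply' (hXd i) hfd]
    rfl
  apply mvfderiv_extChartAt_injective (f q)
  rw [← hφ, ← mvfderiv_comp_apply' hφd hfd, mvfderiv_mlieBracket (hφ2.comp q hf) hY hZ,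
    along hb hZb, along ha hYa, hYa, hZb]
  simp only [map_add, map_sum, map_sub, map_smul, mvfderiv_mlieBracket hφ2 (hX _) (hX _),
    smul_sub, sub_smul, Finset.sum_add_distrib, Finset.sum_sub_distrib, Finset.smul_sum, smul_smul]
  -- Exchanging the summation indices pairs the terms that differentiate the X_i φ into the
  -- commutators [X_i, X_j] φ.
  have hcomm : ∑ i, ∑ j, (b i q * a j q) •
      mvfderiv I (fun x ↦ mvfderiv I φ x (X i x)) (f q) (X j (f q))
      = ∑ i, ∑ j, (a i q * b j q) •
        mvfderiv I (fun x ↦ mvfderiv I φ x (X j x)) (f q) (X i (f q)) := by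
    rw [Finset.sum_comm]
    simp only [mul_comm]
  rw [hcomm]
  abel

end AlongMap

/-! ### The covariant derivative along a map and the Gauss formula. -/

section AlongImmersion
variable {E : Type*} [NormedAddCommGroup E] [NormedSpace ℝ E] [FiniteDimensional ℝ E]
  {H : Type*} [TopologicalSpace H] {I : ModelWithCorners ℝ E H}
  {M : Type*} [TopologicalSpace M] [ChartedSpace H M] [IsManifold I ∞ M]
  {E' : Type*} [NormedAddCommGroup E'] [NormedSpace ℝ E'] [FiniteDimensional ℝ E']
  {H' : Type*} [TopologicalSpace H'] {J : ModelWithCorners ℝ E' H'}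
  {N : Type*} [TopologicalSpace N] [ChartedSpace H' N] [IsManifold J ∞ N]
  {ι : Type*} [Fintype ι]

lemma mdifferentiableAt_of_isLocalFrameOn_univ {X : ι → Π x : M, TangentSpace I x}
    (hX : IsLocalFrameOn I E ∞ X Set.univ) (i : ι) (x : M) : MDiffAt (T% (X i)) x :=
  (hX.contMDiffAt isOpen_univ (Set.mem_univ x) i).mdifferentiableAt (by simp)

/-- Coefficients of a differentiable combination of linearly independent differentiable functions
are differentiable. -/
lemma mdifferentiableAt_of_eq_sum_smul {F : Type*} [NormedAddCommGroup F] [NormedSpace ℝ F]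
    {u : ι → N → F} {w : N → F} {a : ι → N → ℝ} {q : N}
    (hu : ∀ i, MDiffAt (u i) q) (hw : MDiffAt w q) (hli : LinearIndependent ℝ (u · q))
    (hspan : ⊤ ≤ Submodule.span ℝ (Set.range (u · q)))
    (h : ∀ᶠ y in nhds q, w y = ∑ i, a i y • u i y) (i : ι) : MDiffAt (a i) q := by
  have : FiniteDimensional ℝ F := (Module.Basis.mk hli hspan).finiteDimensional_of_finite
  -- `B y` sends coefficients to the combination of the `u i y`. It is invertible at q because these
  -- form a basis there, hence also nearby by openness; the coefficients are then `(B y)⁻¹ (w y)`,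
  -- and inversion of operators is smooth.
  let B : N → (ι → ℝ) →L[ℝ] F := fun y ↦
    ∑ i, (ContinuousLinearMap.smulRightL ℝ (ι → ℝ) F (ContinuousLinearMap.proj i)) (u i y)
  have hB : ∀ y c, B y c = ∑ i, c i • u i y := fun y c ↦ by simp [B]
  have hBd : MDiffAt B q := mdifferentiableAt_sum fun i ↦
    (ContinuousLinearMap.differentiableAt _).mdifferentiableAt.comp q (hu i)
  let e : (ι → ℝ) ≃L[ℝ] F :=
    (Module.Basis.mk hli hspan).equivFun.symm.toContinuousLinearEquiv
  have he : B q = e := by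
    ext c : 1
    rw [hB]
    simp [e, Module.Basis.equivFun_symm_apply]
  have hinv : DifferentiableAt ℝ (ContinuousLinearMap.inverse : ((ι → ℝ) →L[ℝ] F) → _) (B q) := by
    rw [he]
    exact (contDiffAt_map_inverse (n := 1) e).differentiableAt one_ne_zero
  have hunit : ∀ᶠ y in nhds q, (B y).IsInvertible := by
    have := hBd.continuousAt.eventually (he ▸ e.nhds)
    filter_upwards [this] with y hy using hy
  have hd : MDifferentiableAt J 𝓘(ℝ, ι → ℝ) (fun y ↦ (B y).inverse (w y)) q :=
    (hinv.mdifferentiableAt.comp q hBd).clm_apply hw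
  refine ((ContinuousLinearMap.proj (R := ℝ) (φ := fun _ : ι ↦ ℝ)
    i).differentiableAt.mdifferentiableAt.comp q hd).congr_of_eventuallyEq ?_
  filter_upwards [h, hunit] with y hy hy'
  rw [Function.comp_apply, hy, ← hB y fun i ↦ a i y]
  simp [hy'.inverse_apply_self]

/-- The components in a frame on `M` of the pushforward of a vector field along `f : N → M` are
differentiable. -/
lemma mdifferentiableAt_coeff_mfderiv {f : N → M} {q : N} (hf : ContMDiffAt J I 2 f q)
    {X : ι → Π x : M, TangentSpace I x} (hX : IsLocalFrameOn I E ∞ X Set.univ)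
    {Z : Π y : N, TangentSpace J y} (hZ : MDiffAt (T% Z) q) (i : ι) :
    MDiffAt (fun y ↦ hX.coeff i (f y) (mfderiv J I f y (Z y))) q := by
  -- The pushforward of Z is a section along f, not a vector field on M. The differential of the
  -- chart turns it and the frame into E-valued functions on N, to which the preceding lemma
  -- applies.
  set φ : M → E := ⇑(extChartAt I (f q)) with hφ
  have hφ2 : ContMDiffAt I 𝓘(ℝ, E) 2 φ (f q) := contMDiffAt_extChartAt
  have hinv := isInvertible_mfderiv_extChartAt (I := I) (mem_extChartAt_source (I := I) (f q))
  obtain ⟨e, he⟩ := hinv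
  have hmem := Set.mem_univ (f q)
  refine mdifferentiableAt_of_eq_sum_smul
    (u := fun i ↦ (fun x ↦ mvfderiv I φ x (X i x)) ∘ f)
    (w := fun y ↦ mvfderiv J (φ ∘ f) y (Z y))
    (a := fun i y ↦ hX.coeff i (f y) (mfderiv J I f y (Z y)))
    (fun i ↦ (mdifferentiableAt_mvfderiv_apply hφ2
      (mdifferentiableAt_of_isLocalFrameOn_univ hX i _)).comp q (hf.mdifferentiableAt two_ne_zero))
    (mdifferentiableAt_mvfderiv_apply (hφ2.comp q hf) hZ) ?_ ?_ ?_ i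
  · exact (hX.linearIndependent hmem).map' (mvfderiv I φ (f q)).toLinearMap
      (LinearMap.ker_eq_bot.2 (mvfderiv_extChartAt_injective (f q)))
  · have hr : (Set.range fun i ↦ ((fun x ↦ mvfderiv I φ x (X i x)) ∘ f) q)
        = (mvfderiv I φ (f q)).toLinearMap '' Set.range (X · (f q)) := by
      rw [← Set.range_comp]; rfl
    have hsurj : Function.Surjective (mvfderiv I φ (f q)) := fun w ↦
      ⟨e.symm w, (congr($he.symm (e.symm w))).trans (e.apply_symm_apply w)⟩
    rw [hr, Submodule.span_image, top_le_iff.1 (hX.generating hmem), Submodule.map_top]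
    exact (LinearMap.range_eq_top.2 hsurj).ge
  · have h1 := (contMDiffAt_iff_contMDiffAt_nhds (n := 2) (by simp)).1 hf
    have h2 := (contMDiffAt_iff_contMDiffAt_nhds (n := 2) (by simp)).1 hφ2
    filter_upwards [h1, hf.continuousAt.eventually h2] with y h1 h2
    rw [mvfderiv_comp_apply' (h2.mdifferentiableAt two_ne_zero)
      (h1.mdifferentiableAt two_ne_zero)]
    have := (hX.toBasisAt (Set.mem_univ (f y))).sum_repr (mfderiv J I f y (Z y))
    conv_lhs => rw [← this]
    simp [IsLocalFrameOn.coeff]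

/-- The covariant derivative along `f : N → M`, in the direction `v`, of the vector field
`y ↦ ∑ i, a i y • X i (f y)`. -/
def covAlong (cov : CovariantDerivative I E (fun x : M ↦ TangentSpace I x))
    (X : ι → Π x : M, TangentSpace I x) (f : N → M) (a : ι → N → ℝ) (q : N)
    (v : TangentSpace J q) : TangentSpace I (f q) :=
  ∑ i, (mvfderiv J (a i) q v • X i (f q) + a i q • cov (X i) (f q) (mfderiv J I f q v))

variable {g : ContMDiffRiemannianMetric I ∞ E (fun x : M ↦ TangentSpace I x)}
  {cov : CovariantDerivative I E (fun x : M ↦ TangentSpace I x)} {f : N → M} {q : N}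
  {X : ι → Π x : M, TangentSpace I x} {Y Z Z' : Π y : N, TangentSpace J y} {a b c : ι → N → ℝ}

/-- Metric compatibility of `covAlong`. After expansion in the X_i, the compatibility of `cov` is
needed only for pairs X_i, X_j; the product rule accounts for the coefficients. -/
lemma mvfderiv_pullbackForm (h : IsLeviCivita g cov) (hf : MDiffAt f q)
    (hX : ∀ i, MDiffAt (T% (X i)) (f q))
    (hb : ∀ i, MDiffAt (b i) q) (hc : ∀ i, MDiffAt (c i) q)
    (hZ : ∀ y, mfderiv J I f y (Z y) = ∑ i, b i y • X i (f y))
    (hZ' : ∀ y, mfderiv J I f y (Z' y) = ∑ i, c i y • X i (f y)) (v : TangentSpace J q) :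
    mvfderiv J (fun y ↦ pullbackForm (J := J) g f y (Z y) (Z' y)) q v
      = g.inner (f q) (covAlong cov X f b q v) (mfderiv J I f q (Z' q))
        + g.inner (f q) (mfderiv J I f q (Z q)) (covAlong cov X f c q v) := by
  -- Indexing by pairs makes this a single sum of scalar multiples, so the product rule for sums
  -- applies once.
  have e : (fun y ↦ pullbackForm (J := J) g f y (Z y) (Z' y)) = fun y ↦ ∑ p : ι × ι,
      (b p.1 * c p.2) y • ((fun x ↦ g.inner x (X p.1 x) (X p.2 x)) ∘ f) y := by
    ext y
    rw [pullbackForm_apply, hZ, hZ', Fintype.sum_prod_type]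
    simp only [map_sum, map_smul, sum_apply, smul_apply, smul_eq_mul, Finset.mul_sum,
      Pi.mul_apply, Function.comp_apply]
    rw [Finset.sum_comm]
    exact Finset.sum_congr rfl fun i _ ↦ Finset.sum_congr rfl fun j _ ↦ by ring
  rw [e, mvfderiv_sum_smul_apply (a := fun p : ι × ι ↦ b p.1 * c p.2)
    (fun p ↦ (hb p.1).mul (hc p.2)) (fun p ↦ (mdiff_inner (hX p.1) (hX p.2)).comp q hf),
    Fintype.sum_prod_type, hZ, hZ']
  simp only [covAlong, map_sum, map_add, map_smul, sum_apply, add_apply, smul_apply, smul_eq_mul,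
    Finset.mul_sum]
  rw [Finset.sum_comm, ← Finset.sum_add_distrib]
  refine Finset.sum_congr rfl fun j _ ↦ ?_
  rw [← Finset.sum_add_distrib, ← Finset.sum_add_distrib]
  refine Finset.sum_congr rfl fun i _ ↦ ?_
  rw [mvfderiv_comp_apply' (mdiff_inner (hX i) (hX j)) hf, h.1 (hX i) (hX j),
    mvfderiv_mul (hb i) (hc j)]
  simp only [add_apply, smul_apply, smul_eq_mul, Pi.mul_apply, Function.comp_apply]
  ring

/-- Torsion-freeness along f: the derivatives of the coefficients agree with those in the component
formula for df[Y, Z], and what remains is the vanishing torsion of `cov` on the pairs X_i, X_j. -/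
lemma covAlong_sub_covAlong [I.Boundaryless] [J.Boundaryless] (h : IsLeviCivita g cov)
    (hf : ContMDiffAt J I 2 f q) (hX : ∀ i, MDiffAt (T% (X i)) (f q))
    (hYd : MDiffAt (T% Y) q) (hZd : MDiffAt (T% Z) q)
    (ha : ∀ i, MDiffAt (a i) q) (hb : ∀ i, MDiffAt (b i) q)
    (hY : ∀ y, mfderiv J I f y (Y y) = ∑ i, a i y • X i (f y))
    (hZ : ∀ y, mfderiv J I f y (Z y) = ∑ i, b i y • X i (f y)) :
    covAlong cov X f b q (Y q) - covAlong cov X f a q (Z q)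
      = mfderiv J I f q (mlieBracket J Y Z q) := by
  have ht (i j : ι) : mlieBracket I (X i) (X j) (f q)
      = cov (X j) (f q) (X i (f q)) - cov (X i) (f q) (X j (f q)) :=
    ((CovariantDerivative.torsion_eq_zero_iff cov).1 h.2 (hX i) (hX j)).symm
  rw [mfderiv_mlieBracket_of_eq_sum hf hX hYd hZd ha hb hY hZ]
  simp only [covAlong, ht, hY, hZ, map_sum, map_smul, smul_sub, sub_smul, Finset.sum_add_distrib,
    Finset.sum_sub_distrib, Finset.smul_sum, smul_smul]
  have hcomm : ∑ i, ∑ j, (b i q * a j q) • cov (X i) (f q) (X j (f q))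
      = ∑ i, ∑ j, (a i q * b j q) • cov (X j) (f q) (X i (f q)) := by
    rw [Finset.sum_comm]
    simp only [mul_comm]
  rw [hcomm]
  abel

/-- The Gauss formula: the tangential part of the covariant derivative along an immersion is given
by the Koszul formula of the induced metric. -/
lemma inner_covAlong_eq_koszulForm [I.Boundaryless] [J.Boundaryless] (h : IsLeviCivita g cov)
    (hf : ContMDiff J I ∞ f) (hf' : ∀ x, Function.Injective (mfderiv J I f x))
    (hX : ∀ i, MDiffAt (T% (X i)) (f q))
    (hYd : MDiffAt (T% Y) q) (hZd : MDiffAt (T% Z) q) (hZd' : MDiffAt (T% Z') q)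
    (ha : ∀ i, MDiffAt (a i) q) (hb : ∀ i, MDiffAt (b i) q) (hc : ∀ i, MDiffAt (c i) q)
    (hY : ∀ y, mfderiv J I f y (Y y) = ∑ i, a i y • X i (f y))
    (hZ : ∀ y, mfderiv J I f y (Z y) = ∑ i, b i y • X i (f y))
    (hZ' : ∀ y, mfderiv J I f y (Z' y) = ∑ i, c i y • X i (f y)) :
    g.inner (f q) (covAlong cov X f b q (Y q)) (mfderiv J I f q (Z' q))
      = koszulForm (inducedMetric g f hf hf') Z Y Z' q := by
  have hf2 : ContMDiffAt J I 2 f q := (hf q).of_le ENat.LEInfty.out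
  have hfd := hf2.mdifferentiableAt two_ne_zero
  change _ = (1 / 2) * (mvfderiv J (fun y ↦ pullbackForm (J := J) g f y (Z y) (Z' y)) q (Y q)
    + mvfderiv J (fun y ↦ pullbackForm (J := J) g f y (Y y) (Z' y)) q (Z q)
    - mvfderiv J (fun y ↦ pullbackForm (J := J) g f y (Y y) (Z y)) q (Z' q)
    + pullbackForm (J := J) g f q (mlieBracket J Y Z q) (Z' q)
    - pullbackForm (J := J) g f q (mlieBracket J Y Z' q) (Z q)
    - pullbackForm (J := J) g f q (mlieBracket J Z Z' q) (Y q))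
  rw [mvfderiv_pullbackForm h hfd hX hb hc hZ hZ', mvfderiv_pullbackForm h hfd hX ha hc hY hZ',
    mvfderiv_pullbackForm h hfd hX ha hb hY hZ]
  simp only [pullbackForm_apply]
  -- With the brackets written as differences of covariant derivatives, everything cancels except
  -- ⟨D_Y Z, df Z'⟩, which occurs twice and absorbs the factor 1/2.
  rw [← covAlong_sub_covAlong h hf2 hX hYd hZd ha hb hY hZ,
    ← covAlong_sub_covAlong h hf2 hX hYd hZd' ha hc hY hZ',
    ← covAlong_sub_covAlong h hf2 hX hZd hZd' hb hc hZ hZ']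
  simp only [map_sub, sub_apply, g.symm (f q) (mfderiv J I f q _)]
  ring

end AlongImmersion

/-! ### The transformation law as a covariant derivative along f. -/

section TransformationLaw
variable {E : Type*} [NormedAddCommGroup E] [NormedSpace ℝ E] [FiniteDimensional ℝ E]
  {H : Type*} [TopologicalSpace H] {I : ModelWithCorners ℝ E H}
  {M : Type*} [TopologicalSpace M] [ChartedSpace H M] [IsManifold I ∞ M]
  {E' : Type*} [NormedAddCommGroup E'] [NormedSpace ℝ E'] [FiniteDimensional ℝ E']
  {H' : Type*} [TopologicalSpace H'] {J : ModelWithCorners ℝ E' H'}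
  {N : Type*} [TopologicalSpace N] [ChartedSpace H' N] [IsManifold J ∞ N] {n m : ℕ}
  {g : ContMDiffRiemannianMetric I ∞ E (fun x : M ↦ TangentSpace I x)}
  {X : Fin n → Π x : M, TangentSpace I x} {f : N → M}

lemma mfderiv_eq_sum_frameMatrix (hX : IsLocalFrameOn I E ∞ X Set.univ)
    (Xbar : Fin m → Π y : N, TangentSpace J y) (j : Fin m) (y : N) :
    mfderiv J I f y (Xbar j y) = ∑ i, frameMatrix hX f Xbar y i j • X i (f y) := by
  have := (hX.toBasisAt (Set.mem_univ (f y))).sum_repr (mfderiv J I f y (Xbar j y))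
  conv_lhs => rw [← this]
  simp [IsLocalFrameOn.coeff, frameMatrix]

/-- `v = A v̄` are the components of the pushforward of the velocity with components `v̄`. -/
lemma mfderiv_velocity (hX : IsLocalFrameOn I E ∞ X Set.univ)
    (Xbar : Fin m → Π y : N, TangentSpace J y) (y : N) (vbar : Fin m → ℝ) :
    mfderiv J I f y (velocity Xbar y vbar)
      = velocity X (f y) (Matrix.mulVec (frameMatrix hX f Xbar y) vbar) := by
  simp only [velocity, map_sum, map_smul, mfderiv_eq_sum_frameMatrix hX, Finset.smul_sum,
    Matrix.mulVec, dotProduct, Finset.sum_smul, smul_smul]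
  rw [Finset.sum_comm]
  simp only [mul_comm]

lemma frameMatrixDot_apply (hX : IsLocalFrameOn I E ∞ X Set.univ)
    (Xbar : Fin m → Π y : N, TangentSpace J y) (q : N) (vbar : Fin m → ℝ) (i : Fin n)
    (j : Fin m) :
    frameMatrixDot hX f Xbar q vbar i j
      = mvfderiv J (fun y ↦ frameMatrix hX f Xbar y i j) q (velocity Xbar q vbar) := by
  simp [frameMatrixDot, velocity]

/-- The entries of the transformed Coriolis matrix are the inner products of the frame on `N` with
its covariant derivatives along `f`. -/
lemma inducedCoriolis_apply (hX : IsLocalFrameOn I E ∞ X Set.univ)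
    (cov : CovariantDerivative I E (fun x : M ↦ TangentSpace I x))
    (Xbar : Fin m → Π y : N, TangentSpace J y) (q : N) (vbar : Fin m → ℝ) (i j : Fin m) :
    inducedCoriolis g hX (coriolisMatrix g cov X) f Xbar q vbar i j
      = g.inner (f q) (covAlong cov X f (fun k y ↦ frameMatrix hX f Xbar y k j) q
          (velocity Xbar q vbar)) (mfderiv J I f q (Xbar i q)) := by
  rw [g.symm, mfderiv_eq_sum_frameMatrix hX]
  simp only [covAlong, ← frameMatrixDot_apply, mfderiv_velocity hX, inducedCoriolis,
    Matrix.add_apply, Matrix.mul_apply, Matrix.transpose_apply, coriolisMatrix, massMatrix,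
    Matrix.of_apply, map_sum, map_add, map_smul, sum_apply, smul_apply, smul_eq_mul]
  -- Both sides are double sums over frame indices: `Aᵀ C A` matches the terms with `cov (X k)`, and
  -- `Aᵀ H Ȧ` those with differentiated coefficients.
  rw [← Finset.sum_add_distrib]
  refine Finset.sum_congr rfl fun k _ ↦ ?_
  rw [Finset.sum_mul, Finset.sum_mul, ← Finset.sum_add_distrib, Finset.mul_sum, Finset.mul_sum,
    ← Finset.sum_add_distrib]
  exact Finset.sum_congr rfl fun l _ ↦ by ring

theorem inducedCoriolis_coriolisStar [I.Boundaryless] [J.Boundaryless]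
    (hX : IsLocalFrameOn I E ∞ X Set.univ)
    (hf : ContMDiff J I ∞ f) (hf' : ∀ x, Function.Injective (mfderiv J I f x))
    {Xbar : Fin m → Π y : N, TangentSpace J y} (hXbar : IsLocalFrameOn J E' ∞ Xbar Set.univ)
    (q : N) (vbar : Fin m → ℝ) :
    inducedCoriolis g hX (coriolisStar g X) f Xbar q vbar
      = coriolisStar (inducedMetric g f hf hf') Xbar q vbar := by
  have hf2 : ContMDiffAt J I 2 f q := (hf q).of_le ENat.LEInfty.out
  have hd j := mdifferentiableAt_of_isLocalFrameOn_univ hXbar j q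
  have hA i j : MDiffAt (fun y ↦ frameMatrix hX f Xbar y i j) q :=
    mdifferentiableAt_coeff_mfderiv hf2 hX (hd j) i
  -- The Koszul formula needs a vector field as direction, so the velocity at q is extended with
  -- constant components `vbar` in the frame `Xbar`.
  have hW : MDiffAt (T% (fun y ↦ velocity Xbar y vbar)) q :=
    MDifferentiableAt.sum_section fun j _ ↦ mdifferentiableAt_const.smul_section (hd j)
  have hAv i : MDiffAt (fun y ↦ Matrix.mulVec (frameMatrix hX f Xbar y) vbar i) q :=
    mdifferentiableAt_sum (s := .univ) (u := fun j y ↦ frameMatrix hX f Xbar y i j * vbar j)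
      fun j ↦ (hA i j).mul mdifferentiableAt_const
  ext i j
  refine (inducedCoriolis_apply hX (leviCivita g) Xbar q vbar i j).trans ?_
  rw [inner_covAlong_eq_koszulForm (isLeviCivita_leviCivita g) hf hf'
    (Y := fun y ↦ velocity Xbar y vbar) (Z := Xbar j) (Z' := Xbar i)
    (fun k ↦ mdifferentiableAt_of_isLocalFrameOn_univ hX k (f q)) hW (hd j) (hd i) hAv
    (fun k ↦ hA k j) (fun k ↦ hA k i) (fun y ↦ mfderiv_velocity hX Xbar y vbar)
    (mfderiv_eq_sum_frameMatrix hX Xbar j) (mfderiv_eq_sum_frameMatrix hX Xbar i)]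
  rw [← (isLeviCivita_leviCivita (inducedMetric g f hf hf')).eq_koszulForm (hd j) hW (hd i)]
  -- The Coriolis matrix has the covariant derivative in the second slot of the metric, the Koszul
  -- formula in the first.
  exact (inducedMetric g f hf hf').symm q _ _

end TransformationLaw

end CoriolisFactorization

end

theorem mainTheorem2 {n m : ℕ}
    -- the configuration manifold, its kinetic energy metric, and the frame of `v`
    {Q : Type*} [TopologicalSpace Q] [ChartedSpace (EuclideanSpace ℝ (Fin n)) Q]
    [IsManifold (𝓡 n) ∞ Q]
    (g : ContMDiffRiemannianMetric (𝓡 n) ∞ (EuclideanSpace ℝ (Fin n))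
      (fun q : Q ↦ TangentSpace (𝓡 n) q))
    (X : Fin n → Π q : Q, TangentSpace (𝓡 n) q)
    (hX : IsLocalFrameOn (𝓡 n) (EuclideanSpace ℝ (Fin n)) ∞ X Set.univ)
    -- the submanifold, given through its inclusion (any smooth immersion), and the frame of `v̄`
    {Qbar : Type*} [TopologicalSpace Qbar] [ChartedSpace (EuclideanSpace ℝ (Fin m)) Qbar]
    [IsManifold (𝓡 m) ∞ Qbar]
    (f : Qbar → Q) (hf : ContMDiff (𝓡 m) (𝓡 n) ∞ f)
    (hf' : ∀ q, Function.Injective (mfderiv (𝓡 m) (𝓡 n) f q))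
    (Xbar : Fin m → Π q : Qbar, TangentSpace (𝓡 m) q)
    (hXbar : IsLocalFrameOn (𝓡 m) (EuclideanSpace ℝ (Fin m)) ∞ Xbar Set.univ)
    -- a Coriolis factorization on the configuration manifold
    (C : Q → (Fin n → ℝ) → Matrix (Fin n) (Fin n) ℝ)
    (hC : ∀ q v, C q v = CoriolisFactorization.coriolisStar g X q v) :
    ∀ q vbar, CoriolisFactorization.inducedCoriolis g hX C f Xbar q vbar
      = CoriolisFactorization.coriolisStar
          (CoriolisFactorization.inducedMetric g f hf hf') Xbar q vbar := by
  obtain rfl : C = CoriolisFactorization.coriolisStar g X := funext fun q ↦ funext (hC q)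
  exact CoriolisFactorization.inducedCoriolis_coriolisStar hX hf hf' hXbar
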